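/- Let $\mathcal R\subseteq\mathcal L(\mathcal H)$ be a von Neumann algebra on a complex Hilbert space $\mathcal H$, let $\mathcal P(\mathcal R)$ be its complete lattice of projections (with the usual order) and $\mathcal R_{sa}$ the set of its self-adjoint elements. A (bounded) spectral family in $\mathcal R$ is an increasing family $E=(E_\lambda)_{\lambda\in\mathbb R}$ in $\mathcal P(\mathcal R)$ with $\bigwedge_{\mu>\lambda}E_\mu=E_\lambda$ for all $\lambda$ for which there are $a,b\in\mathbb R$ with $E_\lambda=0$ for $\lambda<a$ and $E_\lambda=I$ for $\lambda\ge b$. For $A\in\mathcal R_{sa}$ let $E^A$ be its spectral family, i.e. $E^A_\lambda$ is the spectral projection of $A$ for $(-\infty,\lambda]$, which is the projection onto the kernel of $(A-\lambda I)^+$. The spectral order on $\mathcal R_{sa}$ is defined by $$A\le_s B\quad\Longleftrightarrow\quad E^B_\lambda\le E^A_\lambda\ \text{ for all }\lambda\in\mathbb R .$$ For spectral families $E,F$ in $\mathcal R$, define the spectral families $E\vee F$ and $E\wedge F$ by $$(E\vee F)_\lambda:=E_\lambda\wedge F_\lambda,\qquad (E\wedge F)_\lambda:=\bigwedge_{\mu>\lambda}(E_\mu\vee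 F_\mu)\qquad(\lambda\in\mathbb R),$$ where the operations on the right-hand sides are those of $\mathcal P(\mathcal R)$. Then for all $A,B\in\mathcal R_{sa}$ there are a unique element $A\wedge_s B$ of $\mathcal R_{sa}$ with spectral family $E^A\wedge E^B$ and a unique element $A\vee_s B$ of $\mathcal R_{sa}$ with spectral family $E^A\vee E^B$. The element $A\wedge_s B$ is the infimum and $A\vee_s B$ the supremum of $A$ and $B$ with respect to $\le_s$: one has $A\wedge_s B\le_s A,B$, and $X\le_s A,B$ implies $X\le_s A\wedge_s B$ for every $X\in\mathcal R_{sa}$; similarly $A,B\le_s A\vee_s B$, and $A,B\le_s X$ implies $A\vee_s B\le_s X$. Hence $\le_s$ is a partial order on $\mathcal R_{sa}$ for which $(\mathcal R_{sa},\le_s)$ is a lattice with meet $\wedge_s$ and join $\vee_s$. -/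

import Mathlib

noncomputable section

namespace SpectralOrder

open ContinuousLinearMap

/-- The set of (orthogonal) projections of the von Neumann algebra `R`. -/
def Proj {H : Type*} [NormedAddCommGroup H] [InnerProductSpace ℂ H] [CompleteSpace H]
    (R : VonNeumannAlgebra H) : Type _ :=
  {p : H →L[ℂ] H // p ∈ R ∧ IsStarProjection p}

namespace Proj

/-- Projections carry the usual operator order: `p ≤ q` iff `q - p` is a positive operator. -/
instance instPartialOrder {H : Type*} [NormedAddCommGroup H] [InnerProductSpace ℂ H]
    [CompleteSpace H] (R : VonNeumannAlgebra H) : PartialOrder (Proj R) :=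
  inferInstanceAs (PartialOrder {p : H →L[ℂ] H // p ∈ R ∧ IsStarProjection p})

/-- The orthogonal projection onto a closed subspace that is invariant under the commutant
of `R`; it belongs to `R`. -/
def ofSubmodule {H : Type*} [NormedAddCommGroup H] [InnerProductSpace ℂ H] [CompleteSpace H]
    (R : VonNeumannAlgebra H) (K : Submodule ℂ H) (hK : IsClosed (K : Set H))
    (hR : ∀ y ∈ R.commutant, ∀ x ∈ K, y x ∈ K) : Proj R :=
  haveI : CompleteSpace K := hK.completeSpace_coe
  ⟨K.starProjection, by
    refine ⟨?_, isStarProjection_starProjection⟩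
    rw [VonNeumannAlgebra.IsStarProjection.mem_iff isStarProjection_starProjection]
    intro y hy
    rw [Module.End.mem_invtSubmodule_iff_forall_mem_of_mem]
    intro x hx
    rw [Submodule.range_starProjection] at hx ⊢
    exact hR y hy x hx⟩

theorem range_ofSubmodule {H : Type*} [NormedAddCommGroup H] [InnerProductSpace ℂ H]
    [CompleteSpace H] (R : VonNeumannAlgebra H) (K : Submodule ℂ H) (hK : IsClosed (K : Set H))
    (hR : ∀ y ∈ R.commutant, ∀ x ∈ K, y x ∈ K) :
    (ofSubmodule R K hK hR).1.range = K := by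
  have : CompleteSpace K := hK.completeSpace_coe
  exact Submodule.range_starProjection K

theorem le_iff_range {H : Type*} [NormedAddCommGroup H] [InnerProductSpace ℂ H]
    [CompleteSpace H] {R : VonNeumannAlgebra H} (p q : Proj R) :
    p ≤ q ↔ p.1.range ≤ q.1.range := by
  obtain ⟨hp, hp'⟩ := isStarProjection_iff_eq_starProjection_range.mp p.2.2
  obtain ⟨hq, hq'⟩ := isStarProjection_iff_eq_starProjection_range.mp q.2.2
  rw [← Submodule.starProjection_le_starProjection_iff, ← hp', ← hq']
  rfl

theorem range_mem {H : Type*} [NormedAddCommGroup H] [InnerProductSpace ℂ H]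
    [CompleteSpace H] {R : VonNeumannAlgebra H} (p : Proj R) (y : H →L[ℂ] H)
    (hy : y ∈ R.commutant) (x : H) (hx : x ∈ p.1.range) : y x ∈ p.1.range := by
  have h := (VonNeumannAlgebra.IsStarProjection.mem_iff p.2.2 R).mp p.2.1 y hy
  rw [Module.End.mem_invtSubmodule_iff_forall_mem_of_mem] at h
  exact h x hx

theorem isClosed_range {H : Type*} [NormedAddCommGroup H] [InnerProductSpace ℂ H]
    [CompleteSpace H] {R : VonNeumannAlgebra H} (p : Proj R) :
    IsClosed (p.1.range : Set H) :=
  ContinuousLinearMap.IsIdempotentElem.isClosed_range p.2.2.isIdempotentElem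

/-- The infimum of a set of projections: the projection onto the intersection of the ranges. -/
instance instInfSet {H : Type*} [NormedAddCommGroup H] [InnerProductSpace ℂ H]
    [CompleteSpace H] (R : VonNeumannAlgebra H) : InfSet (Proj R) where
  sInf S := ofSubmodule R (⨅ p : S, p.1.1.range)
    (by
      rw [Submodule.coe_iInf]
      exact isClosed_iInter fun p => p.1.isClosed_range)
    (by
      intro y hy x hx
      rw [Submodule.mem_iInf] at hx ⊢
      exact fun p => p.1.range_mem y hy x (hx p))

theorem range_sInf {H : Type*} [NormedAddCommGroup H] [InnerProductSpace ℂ H]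
    [CompleteSpace H] {R : VonNeumannAlgebra H} (S : Set (Proj R)) :
    (sInf S : Proj R).1.range = ⨅ p : S, p.1.1.range :=
  range_ofSubmodule _ _ _ _

/-- The complete lattice of projections of `R`. -/
instance instCompleteLattice {H : Type*} [NormedAddCommGroup H] [InnerProductSpace ℂ H]
    [CompleteSpace H] (R : VonNeumannAlgebra H) : CompleteLattice (Proj R) :=
  completeLatticeOfInf (Proj R) (by
    intro S
    refine ⟨fun p hp => ?_, fun q hq => ?_⟩
    · rw [le_iff_range, range_sInf]
      exact iInf_le (fun p : S => p.1.1.range) ⟨p, hp⟩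
    · rw [le_iff_range, range_sInf]
      exact le_iInf fun p => (le_iff_range _ _).mp (hq p.2))

end Proj

/-- A (bounded) spectral family in `R`: an increasing family of projections of `R`, continuous
from the right, which is `0` for all small and `1` for all large real numbers. -/
structure SpectralFamily {H : Type*} [NormedAddCommGroup H] [InnerProductSpace ℂ H]
    [CompleteSpace H] (R : VonNeumannAlgebra H) where
  /-- the projection `E_t` of the family -/
  proj : ℝ → Proj R
  monotone : Monotone proj
  right_cont : ∀ t, ⨅ s : Set.Ioi t, proj s = proj t
  eq_bot : ∃ a, ∀ t < a, proj t = ⊥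
  eq_top : ∃ b, ∀ t, b ≤ t → proj t = ⊤

namespace SpectralFamily

/-- The spectral family `E ∨ F`, with `(E ∨ F)_t = E_t ∧ F_t`. -/
def join {H : Type*} [NormedAddCommGroup H] [InnerProductSpace ℂ H] [CompleteSpace H]
    {R : VonNeumannAlgebra H} (E F : SpectralFamily R) : SpectralFamily R where
  proj t := E.proj t ⊓ F.proj t
  monotone _ _ h := inf_le_inf (E.monotone h) (F.monotone h)
  right_cont t := by rw [iInf_inf_eq, E.right_cont, F.right_cont]
  eq_bot := by
    obtain ⟨a, ha⟩ := E.eq_bot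
    exact ⟨a, fun t ht => by rw [ha t ht, bot_inf_eq]⟩
  eq_top := by
    obtain ⟨a, ha⟩ := E.eq_top
    obtain ⟨b, hb⟩ := F.eq_top
    refine ⟨max a b, fun t ht => ?_⟩
    rw [ha t (le_trans (le_max_left a b) ht), hb t (le_trans (le_max_right a b) ht), inf_top_eq]

/-- The spectral family `E ∧ F`, with `(E ∧ F)_t = ⋀_{s > t} (E_s ∨ F_s)`. -/
def meet {H : Type*} [NormedAddCommGroup H] [InnerProductSpace ℂ H] [CompleteSpace H]
    {R : VonNeumannAlgebra H} (E F : SpectralFamily R) : SpectralFamily R where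
  proj t := ⨅ s : Set.Ioi t, E.proj s ⊔ F.proj s
  monotone t u h := le_iInf fun s => iInf_le (fun s : Set.Ioi t => E.proj s ⊔ F.proj s)
    ⟨s.1, lt_of_le_of_lt h s.2⟩
  right_cont t := by
    apply le_antisymm
    · refine le_iInf fun s => ?_
      obtain ⟨r, hr, hs⟩ := exists_between (Set.mem_Ioi.mp s.2)
      exact (iInf_le _ (⟨r, hr⟩ : Set.Ioi t)).trans (iInf_le _ (⟨s.1, hs⟩ : Set.Ioi r))
    · refine le_iInf fun s => le_iInf fun r => ?_
      exact iInf_le (fun s : Set.Ioi t => E.proj s ⊔ F.proj s) ⟨r.1, lt_trans (Set.mem_Ioi.mp s.2) (Set.mem_Ioi.mp r.2)⟩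
  eq_bot := by
    obtain ⟨a, ha⟩ := E.eq_bot
    obtain ⟨b, hb⟩ := F.eq_bot
    refine ⟨min a b, fun t ht => ?_⟩
    obtain ⟨s, hs, hs'⟩ := exists_between ht
    rw [eq_bot_iff]
    refine (iInf_le _ (⟨s, hs⟩ : Set.Ioi t)).trans ?_
    simp only [ha s (lt_of_lt_of_le hs' (min_le_left a b)),
      hb s (lt_of_lt_of_le hs' (min_le_right a b)), sup_idem, le_refl]
  eq_top := by
    obtain ⟨b, hb⟩ := E.eq_top
    refine ⟨b, fun t ht => ?_⟩
    rw [eq_top_iff]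
    refine le_iInf fun s => ?_
    rw [hb s (le_trans ht (le_of_lt s.2)), top_sup_eq]

end SpectralFamily

theorem posPart_sub_eq_cfc {H : Type*} [NormedAddCommGroup H] [InnerProductSpace ℂ H]
    [CompleteSpace H] {a : H →L[ℂ] H} (ha : IsSelfAdjoint a) (t : ℝ) :
    (a - algebraMap ℝ (H →L[ℂ] H) t)⁺ = cfc (fun x : ℝ => max (x - t) 0) a := by
  have h1 : a - algebraMap ℝ (H →L[ℂ] H) t = cfc (fun x : ℝ => x - t) a := by
    rw [cfc_sub (fun x : ℝ => x) (fun _ => t) a, cfc_id' ℝ a, cfc_const t a]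
  rw [CFC.posPart_def, cfcₙ_eq_cfc, h1, ← cfc_comp (fun x : ℝ => x⁺) (fun x : ℝ => x - t) a]
  rfl

theorem ker_posPart_mono {H : Type*} [NormedAddCommGroup H] [InnerProductSpace ℂ H]
    [CompleteSpace H] {a : H →L[ℂ] H} (ha : IsSelfAdjoint a) {s t : ℝ} (hst : s ≤ t) {x : H}
    (hx : (a - algebraMap ℝ (H →L[ℂ] H) s)⁺ x = 0) :
    (a - algebraMap ℝ (H →L[ℂ] H) t)⁺ x = 0 := by
  rcases hst.eq_or_lt with rfl | hlt
  · exact hx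
  rw [posPart_sub_eq_cfc ha] at hx ⊢
  have hpos : ∀ y : ℝ, max (y - s) (t - s) ≠ 0 := fun y =>
    ne_of_gt (lt_of_lt_of_le (sub_pos.mpr hlt) (le_max_right _ _))
  have hg : Continuous fun y : ℝ => max (y - t) 0 / max (y - s) (t - s) :=
    Continuous.div (by fun_prop) (by fun_prop) hpos
  have h : (fun y : ℝ => max (y - t) 0) =
      fun y => (max (y - t) 0 / max (y - s) (t - s)) * max (y - s) 0 := by
    funext y
    rcases le_total y t with h | h
    · rw [max_eq_right (sub_nonpos.mpr h)]; simp
    · have h2 : 0 < y - s := by linarith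
      rw [max_eq_left (by linarith : t - s ≤ y - s), max_eq_left h2.le]
      field_simp
  rw [h, cfc_mul _ _ a hg.continuousOn (by fun_prop)]
  simp [hx]

/-- The projection `E^A_t` of the spectral family of the self-adjoint element `A` of `R`, i.e.
the spectral projection of `A` for `(-∞, t]`: the projection onto the kernel of `(A - t)⁺`. -/
def spectralProj {H : Type*} [NormedAddCommGroup H] [InnerProductSpace ℂ H] [CompleteSpace H]
    {R : VonNeumannAlgebra H} (A : selfAdjoint R) (t : ℝ) : Proj R :=
  Proj.ofSubmodule R (((A : R) : H →L[ℂ] H) - algebraMap ℝ (H →L[ℂ] H) t)⁺.ker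
    (((A : R) : H →L[ℂ] H) - algebraMap ℝ (H →L[ℂ] H) t)⁺.isClosed_ker
    (by
      intro y hy x hx
      have hA : IsSelfAdjoint ((A : R) : H →L[ℂ] H) := congrArg Subtype.val A.2
      have hc : Commute ((A : R) : H →L[ℂ] H) y :=
        VonNeumannAlgebra.mem_commutant_iff.mp hy _ (A : R).2
      rw [posPart_sub_eq_cfc hA] at hx ⊢
      have h := hc.cfc_real (fun x : ℝ => max (x - t) 0)
      have hx' : cfc (fun x : ℝ => max (x - t) 0) ((A : R) : H →L[ℂ] H) x = 0 := hx
      have h2 : cfc (fun x : ℝ => max (x - t) 0) ((A : R) : H →L[ℂ] H) (y x) =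
          y (cfc (fun x : ℝ => max (x - t) 0) ((A : R) : H →L[ℂ] H) x) :=
        congrArg (fun T : H →L[ℂ] H => T x) h.eq
      rw [hx', map_zero] at h2
      exact h2)

theorem mem_range_spectralProj {H : Type*} [NormedAddCommGroup H] [InnerProductSpace ℂ H]
    [CompleteSpace H] {R : VonNeumannAlgebra H} (A : selfAdjoint R) (t : ℝ) (x : H) :
    x ∈ (spectralProj A t).1.range ↔
      (((A : R) : H →L[ℂ] H) - algebraMap ℝ (H →L[ℂ] H) t)⁺ x = 0 := by
  rw [spectralProj, Proj.range_ofSubmodule]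
  rfl

/-- The spectral family `E^A` of a self-adjoint element `A` of `R`. -/
def spectralFamily {H : Type*} [NormedAddCommGroup H] [InnerProductSpace ℂ H] [CompleteSpace H]
    {R : VonNeumannAlgebra H} (A : selfAdjoint R) : SpectralFamily R where
  proj := spectralProj A
  monotone s t hst := by
    have hA : IsSelfAdjoint ((A : R) : H →L[ℂ] H) := congrArg Subtype.val A.2
    rw [Proj.le_iff_range]
    intro x hx
    rw [mem_range_spectralProj] at hx ⊢
    exact ker_posPart_mono hA hst hx
  right_cont t := by
    have hA : IsSelfAdjoint ((A : R) : H →L[ℂ] H) := congrArg Subtype.val A.2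
    apply le_antisymm
    · rw [Proj.le_iff_range]
      intro x hx
      rw [mem_range_spectralProj]
      have hx' : ∀ s, t < s → (((A : R) : H →L[ℂ] H) - algebraMap ℝ (H →L[ℂ] H) s)⁺ x = 0 := by
        intro s hs
        rw [← mem_range_spectralProj]
        exact (Proj.le_iff_range _ _).mp
          (iInf_le (fun s : Set.Ioi t => spectralProj A s) ⟨s, hs⟩) hx
      rw [posPart_sub_eq_cfc hA]
      have hb : ∀ s, t < s →
          ‖cfc (fun y : ℝ => max (y - t) 0) ((A : R) : H →L[ℂ] H) x‖ ≤ (s - t) * ‖x‖ := by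
        intro s hs
        have h0 := hx' s hs
        rw [posPart_sub_eq_cfc hA] at h0
        have h1 : cfc (fun y : ℝ => max (y - t) 0) ((A : R) : H →L[ℂ] H) x =
            cfc (fun y : ℝ => max (y - t) 0 - max (y - s) 0) ((A : R) : H →L[ℂ] H) x := by
          rw [cfc_sub (fun y : ℝ => max (y - t) 0) (fun y : ℝ => max (y - s) 0),
            sub_apply, h0, sub_zero]
        rw [h1]
        refine (ContinuousLinearMap.le_opNorm _ _).trans ?_
        gcongr
        refine norm_cfc_le (by linarith) fun y _ => ?_
        rw [Real.norm_eq_abs, abs_le]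
        constructor <;> rcases max_cases (y - t) 0 with h | h <;>
          rcases max_cases (y - s) 0 with h' | h' <;> linarith
      rw [← norm_le_zero_iff]
      have hlim : Filter.Tendsto (fun s : ℝ => (s - t) * ‖x‖) (nhdsWithin t (Set.Ioi t))
          (nhds ((t - t) * ‖x‖)) :=
        (Continuous.tendsto (by fun_prop) t).mono_left nhdsWithin_le_nhds
      rw [sub_self, zero_mul] at hlim
      exact ge_of_tendsto hlim (Filter.eventually_of_mem self_mem_nhdsWithin hb)
    · refine le_iInf fun s => ?_
      rw [Proj.le_iff_range]
      intro x hx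
      rw [mem_range_spectralProj] at hx ⊢
      exact ker_posPart_mono hA (le_of_lt s.2) hx
  eq_bot := by
    have hA : IsSelfAdjoint ((A : R) : H →L[ℂ] H) := congrArg Subtype.val A.2
    rcases subsingleton_or_nontrivial H with hH | hH
    · refine ⟨0, fun t _ => ?_⟩
      rw [eq_bot_iff, Proj.le_iff_range]
      intro x _
      rw [Subsingleton.elim x 0]
      exact Submodule.zero_mem _
    refine ⟨-‖((A : R) : H →L[ℂ] H)‖, fun t ht => ?_⟩
    rw [eq_bot_iff, Proj.le_iff_range]
    intro x hx
    rw [mem_range_spectralProj, posPart_sub_eq_cfc hA] at hx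
    set a : H →L[ℂ] H := ((A : R) : H →L[ℂ] H)
    have hpos : ∀ y : ℝ, max (y - t) (-‖a‖ - t) ≠ 0 := fun y =>
      ne_of_gt (lt_of_lt_of_le (sub_pos.mpr ht) (le_max_right _ _))
    have hg : Continuous fun y : ℝ => (max (y - t) (-‖a‖ - t))⁻¹ :=
      Continuous.inv₀ (by fun_prop) hpos
    have h1 : cfc (fun y : ℝ => (max (y - t) (-‖a‖ - t))⁻¹ * max (y - t) 0) a = 1 := by
      rw [← cfc_const_one ℝ a]
      refine cfc_congr fun y hy => ?_
      have hy1 : |y| ≤ ‖a‖ := spectrum.norm_le_norm_of_mem hy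
      have hy2 := (abs_le.mp hy1).1
      rw [max_eq_left (by linarith : -‖a‖ - t ≤ y - t),
        max_eq_left (by linarith : (0 : ℝ) ≤ y - t)]
      exact inv_mul_cancel₀ (by linarith)
    rw [cfc_mul _ _ a hg.continuousOn (by fun_prop)] at h1
    have h2 : cfc (fun y : ℝ => (max (y - t) (-‖a‖ - t))⁻¹) a
        (cfc (fun y : ℝ => max (y - t) 0) a x) = x :=
      congrArg (fun T : H →L[ℂ] H => T x) h1
    rw [hx, map_zero] at h2
    rw [← h2]
    exact Submodule.zero_mem _
  eq_top := by
    have hA : IsSelfAdjoint ((A : R) : H →L[ℂ] H) := congrArg Subtype.val A.2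
    rcases subsingleton_or_nontrivial H with hH | hH
    · refine ⟨0, fun t _ => ?_⟩
      rw [eq_top_iff, Proj.le_iff_range]
      intro x _
      rw [Subsingleton.elim x 0]
      exact Submodule.zero_mem _
    refine ⟨‖((A : R) : H →L[ℂ] H)‖, fun t ht => ?_⟩
    rw [eq_top_iff, Proj.le_iff_range]
    intro x _
    rw [mem_range_spectralProj, posPart_sub_eq_cfc hA]
    have h0 : cfc (fun y : ℝ => max (y - t) 0) ((A : R) : H →L[ℂ] H) = 0 := by
      rw [← cfc_const_zero ℝ ((A : R) : H →L[ℂ] H)]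
      refine cfc_congr fun y hy => ?_
      have hy1 : |y| ≤ ‖((A : R) : H →L[ℂ] H)‖ := spectrum.norm_le_norm_of_mem hy
      exact max_eq_right (by linarith [(abs_le.mp hy1).2])
    rw [h0, zero_apply]

/-- The spectral order on the self-adjoint elements of `R`: `A ≤_s B` iff `E^B_t ≤ E^A_t` for
all real `t`. -/
def SpecLE {H : Type*} [NormedAddCommGroup H] [InnerProductSpace ℂ H] [CompleteSpace H]
    {R : VonNeumannAlgebra H} (A B : selfAdjoint R) : Prop :=
  ∀ t : ℝ, (spectralFamily B).proj t ≤ (spectralFamily A).proj t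

/-- `C` is `A ∧_s B`: the element of `R_sa` whose spectral family is `E^A ∧ E^B`. -/
def IsSpecMeet {H : Type*} [NormedAddCommGroup H] [InnerProductSpace ℂ H] [CompleteSpace H]
    {R : VonNeumannAlgebra H} (A B C : selfAdjoint R) : Prop :=
  spectralFamily C = (spectralFamily A).meet (spectralFamily B)

/-- `D` is `A ∨_s B`: the element of `R_sa` whose spectral family is `E^A ∨ E^B`. -/
def IsSpecJoin {H : Type*} [NormedAddCommGroup H] [InnerProductSpace ℂ H] [CompleteSpace H]
    {R : VonNeumannAlgebra H} (A B D : selfAdjoint R) : Prop :=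
  spectralFamily D = (spectralFamily A).join (spectralFamily B)

end SpectralOrder

end

/-!
The map `A ↦ E^A` is a bijection from the self-adjoint elements of `R` onto the bounded spectral
families in `R`. The spectral order is, by definition, the pointwise order of spectral families
reversed, and for that order `E ∧ F` and `E ∨ F` are the greatest lower and the least upper bound
(right continuity gives `⋀_{s > t} E_s = E_t`, which turns `⋀_{s > t} (E_s ∨ F_s)` into a bound for
right continuous families). So the bijection carries the lattice of spectral families over to
`R_sa`.

The bijection goes through the relation `E.Resolves ε T`: the operator `T` commutes with every
`E_t`, is at least `t` on the range of `1 - E_t` and at most `t + ε` on the range of `E_t`. For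
`ε = 0` it means that `T = ∫ t dE_t`.

* `resolves_spectralFamily`: `E^A` resolves `A`, since `(A - t)⁺ = (A - t)(1 - E_t)`.
* `spectralFamily_eq_of_resolves`: no other spectral family resolves `A`. If `E` resolves `A`, the
  decomposition of `A - t` along `E_t` is the one into positive and negative part, so that `E^A_t`
  projects onto the kernel of `(A - t)(1 - E_t)`; an eigenvector of `A` at `t` lies in the range of
  `E_s` for all `s > t`, hence in that of `E_t` by right continuity.
* `SpectralFamily.Resolves.norm_sub_le`: two operators resolved by `E` up to `ε` are within `3 r` of
  each other for all `r > ε`. Indeed, on each increment `E_s - E_t` of a partition both lie between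
  `t` and `s + ε`. For `ε = 0` this is injectivity.
* `SpectralFamily.exists_resolves`: the Riemann sums of `a + ∫ (1 - E_t) dt` of mesh `ε` are resolved
  by `E` up to `ε`. By the preceding estimate they form a Cauchy sequence as `ε` tends to `0`; the
  limit lies in `R`, which is norm closed, and is resolved by `E`. This is surjectivity.
-/

noncomputable section

namespace SpectralOrder

open Filter Topology

variable {H : Type*} [NormedAddCommGroup H] [InnerProductSpace ℂ H] [CompleteSpace H]
  {R : VonNeumannAlgebra H}

/-! ### Projections and spectral families as operators -/

namespace Proj

theorem le_def (p q : Proj R) : p ≤ q ↔ p.1 ≤ q.1 := Iff.rfl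

theorem coe_bot : (⊥ : Proj R).1 = 0 :=
  le_antisymm ((le_def ⊥ ⟨0, zero_mem R, .zero _⟩).1 bot_le) (⊥ : Proj R).2.2.nonneg

theorem coe_top : (⊤ : Proj R).1 = 1 :=
  le_antisymm (⊤ : Proj R).2.2.le_one ((le_def ⟨1, one_mem R, .one _⟩ ⊤).1 le_top)

theorem mem_range_iff (p : Proj R) (x : H) : x ∈ p.1.range ↔ p.1 x = x := by
  refine ⟨?_, fun h => ⟨x, h⟩⟩
  rintro ⟨y, rfl⟩
  exact congrArg (fun T : H →L[ℂ] H => T y) p.2.2.isIdempotentElem.eq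

theorem eq_of_range {p q : Proj R} (h : ∀ x, x ∈ p.1.range ↔ x ∈ q.1.range) : p = q :=
  le_antisymm ((le_iff_range p q).2 fun x hx => (h x).1 hx)
    ((le_iff_range q p).2 fun x hx => (h x).2 hx)

end Proj

namespace SpectralFamily

theorem ext_proj {E F : SpectralFamily R} (h : ∀ t, E.proj t = F.proj t) : E = F := by
  cases E; cases F; congr; exact funext h

/-- The projection `E_t` of a spectral family, as a bounded operator. -/
def op (E : SpectralFamily R) (t : ℝ) : H →L[ℂ] H := (E.proj t).1

variable (E : SpectralFamily R)

theorem isStarProjection_op (t : ℝ) : IsStarProjection (E.op t) := (E.proj t).2.2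

theorem op_mem (t : ℝ) : E.op t ∈ R := (E.proj t).2.1

theorem op_mul_self (t : ℝ) : E.op t * E.op t = E.op t :=
  (E.isStarProjection_op t).isIdempotentElem.eq

theorem op_mono {s t : ℝ} (h : s ≤ t) : E.op s ≤ E.op t := E.monotone h

theorem op_mul_op_of_le {s t : ℝ} (h : s ≤ t) : E.op s * E.op t = E.op s :=
  ((E.isStarProjection_op s).le_iff_mul_eq_left (E.isStarProjection_op t)).1 (E.op_mono h)

theorem op_mul_op_of_ge {s t : ℝ} (h : s ≤ t) : E.op t * E.op s = E.op s :=
  ((E.isStarProjection_op s).le_iff_mul_eq_right (E.isStarProjection_op t)).1 (E.op_mono h)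

theorem commute_op (s t : ℝ) : Commute (E.op s) (E.op t) := by
  rcases le_total s t with h | h
  · rw [commute_iff_eq, E.op_mul_op_of_le h, E.op_mul_op_of_ge h]
  · rw [commute_iff_eq, E.op_mul_op_of_le h, E.op_mul_op_of_ge h]

theorem exists_op_eq_zero : ∃ a, ∀ t < a, E.op t = 0 := by
  obtain ⟨a, ha⟩ := E.eq_bot
  exact ⟨a, fun t ht => by rw [op, ha t ht, Proj.coe_bot]⟩

theorem exists_op_eq_one : ∃ b, ∀ t, b ≤ t → E.op t = 1 := by
  obtain ⟨b, hb⟩ := E.eq_top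
  exact ⟨b, fun t ht => by rw [op, hb t ht, Proj.coe_top]⟩

/-! ### Operators resolved by a spectral family -/

/-- The operator `T` has `E` as its spectral resolution up to an error `ε`: it commutes with every
`E_t`, it is at least `t` on the range of `1 - E_t`, and at most `t + ε` on the range of `E_t`.
For `ε = 0` this says that `T = ∫ t dE_t`. -/
structure Resolves (ε : ℝ) (T : H →L[ℂ] H) : Prop where
  commute : ∀ t, Commute T (E.op t)
  lower : ∀ t : ℝ, t • (1 - E.op t) ≤ T * (1 - E.op t)
  upper : ∀ t : ℝ, T * E.op t ≤ (t + ε) • E.op t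

variable {E}

theorem Resolves.mono {ε δ : ℝ} {T : H →L[ℂ] H} (h : E.Resolves ε T) (hεδ : ε ≤ δ) :
    E.Resolves δ T where
  commute := h.commute
  lower := h.lower
  upper t := (h.upper t).trans
    (smul_le_smul_of_nonneg_right (by linarith) (E.isStarProjection_op t).nonneg)

theorem Resolves.isSelfAdjoint {ε : ℝ} {T : H →L[ℂ] H} (h : E.Resolves ε T) :
    IsSelfAdjoint T := by
  obtain ⟨a, ha⟩ := E.exists_op_eq_zero
  have h1 := h.lower (a - 1)
  rw [ha _ (by linarith), sub_zero, mul_one] at h1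
  have h2 : IsSelfAdjoint (T - (a - 1) • (1 : H →L[ℂ] H)) := (sub_nonneg.2 h1).isSelfAdjoint
  have h3 := h2.add (IsSelfAdjoint.algebraMap (H →L[ℂ] H) (IsSelfAdjoint.all (a - 1)))
  rwa [Algebra.algebraMap_eq_smul_one, sub_add_cancel] at h3

/-- On the range of the increment `E_s - E_t`, an operator resolved by `E` lies between `t`
and `s`, up to the error. -/
theorem Resolves.increment {ε : ℝ} {T : H →L[ℂ] H} (h : E.Resolves ε T) {t s : ℝ}
    (hts : t ≤ s) :
    t • (E.op s - E.op t) ≤ T * (E.op s - E.op t) ∧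
      T * (E.op s - E.op t) ≤ (s + ε) • (E.op s - E.op t) := by
  have hs := E.op_mul_self s
  have h1 := E.op_mul_op_of_le hts
  have h2 := E.op_mul_op_of_ge hts
  have ht := E.op_mul_self t
  have hc := (h.commute s).eq
  constructor
  · have := (E.isStarProjection_op s).isSelfAdjoint.conjugate_le_conjugate (h.lower t)
    convert this using 1
    · simp only [mul_sub, sub_mul, mul_smul_comm, smul_mul_assoc, mul_one, hs, h1, h2]
    · rw [← mul_assoc, ← hc, mul_assoc, mul_assoc]
      congr 1
      simp only [mul_sub, sub_mul, one_mul, hs, h1, h2]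
  · have := (E.isStarProjection_op t).one_sub.isSelfAdjoint.conjugate_le_conjugate (h.upper s)
    have e : (1 - E.op t) * E.op s * (1 - E.op t) = E.op s - E.op t := by
      simp only [mul_sub, sub_mul, mul_one, one_mul, ht, h1, h2, sub_self, sub_zero]
    convert this using 1
    · have : Commute T (1 - E.op t) := (Commute.one_right T).sub_right (h.commute t)
      rw [← mul_assoc, ← this.eq, mul_assoc, mul_assoc, ← mul_assoc (1 - E.op t), e]
    · rw [mul_smul_comm, smul_mul_assoc, e]

/-- Two operators resolved by `E` differ by little on each increment of a fine partition, and
the increments add up to `1`. -/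
theorem Resolves.sub_le {ε : ℝ} {T T' : H →L[ℂ] H} (h : E.Resolves ε T) (h' : E.Resolves ε T')
    {r : ℝ} (hr : ε < r) : T - T' ≤ r • (1 : H →L[ℂ] H) := by
  obtain ⟨a, ha⟩ := E.exists_op_eq_zero
  obtain ⟨b, hb⟩ := E.exists_op_eq_one
  -- The mesh `d = r - ε` absorbs the oscillation of `t` on each increment.
  set d := r - ε with hd
  have hd0 : 0 < d := by linarith
  obtain ⟨N, hN⟩ := exists_nat_ge ((b - (a - 1)) / d)
  rw [div_le_iff₀ hd0] at hN
  let p : ℕ → H →L[ℂ] H := fun k => E.op (a - 1 + k * d)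
  have hsum : ∑ k ∈ Finset.range N, (p (k + 1) - p k) = 1 := by
    rw [Finset.sum_range_sub]
    simp only [p]
    rw [hb _ (by linarith), ha _ (by simp), sub_zero]
  rw [← mul_one (T - T'), ← hsum, Finset.mul_sum, Finset.smul_sum]
  refine Finset.sum_le_sum fun k _ => ?_
  have hk : a - 1 + k * d ≤ a - 1 + (k + 1 : ℕ) * d := by push_cast; linarith
  have h1 := (h.increment hk).2
  have h2 := (h'.increment hk).1
  rw [sub_mul]
  refine (sub_le_sub h1 h2).trans_eq ?_
  rw [← sub_smul]
  congr 1
  push_cast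
  linarith

/-- An operator is determined, up to a multiple of the error, by the family resolving it. -/
theorem Resolves.norm_sub_le {ε : ℝ} {T T' : H →L[ℂ] H} (h : E.Resolves ε T)
    (h' : E.Resolves ε T') {r : ℝ} (hr0 : 0 ≤ r) (hr : ε < r) : ‖T - T'‖ ≤ 3 * r := by
  have h1 := h.sub_le h' hr
  have h2 := h'.sub_le h hr
  have hone : ‖r • (1 : H →L[ℂ] H)‖ ≤ r := by
    rw [norm_smul, Real.norm_of_nonneg hr0]
    exact mul_le_of_le_one_right hr0 ContinuousLinearMap.norm_id_le
  have h3 : 0 ≤ T - T' + r • (1 : H →L[ℂ] H) := by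
    have := sub_nonneg.2 h2
    convert this using 1
    abel
  have h4 : T - T' + r • (1 : H →L[ℂ] H) ≤ r • (1 : H →L[ℂ] H) + r • (1 : H →L[ℂ] H) := by gcongr
  have h5 := CStarAlgebra.norm_le_norm_of_nonneg_of_le h3 h4
  calc ‖T - T'‖ = ‖(T - T' + r • (1 : H →L[ℂ] H)) - r • (1 : H →L[ℂ] H)‖ := by
        rw [add_sub_cancel_right]
    _ ≤ ‖T - T' + r • (1 : H →L[ℂ] H)‖ + ‖r • (1 : H →L[ℂ] H)‖ := _root_.norm_sub_le _ _
    _ ≤ (‖r • (1 : H →L[ℂ] H)‖ + ‖r • (1 : H →L[ℂ] H)‖) + ‖r • (1 : H →L[ℂ] H)‖ := by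
        gcongr
        exact h5.trans (norm_add_le _ _)
    _ ≤ 3 * r := by linarith

theorem Resolves.eq {T T' : H →L[ℂ] H} (h : E.Resolves 0 T) (h' : E.Resolves 0 T') :
    T = T' := by
  rw [← sub_eq_zero, ← norm_le_zero_iff]
  refine le_of_forall_pos_le_add fun r hr => ?_
  have := h.norm_sub_le h' (r := r / 3) (by positivity) (by positivity)
  linarith

end SpectralFamily

/-! ### The spectral family of a self-adjoint operator as its unique resolution -/

theorem spectralFamily_op_apply_eq_iff (A : selfAdjoint R) (t : ℝ) (x : H) :
    (spectralFamily A).op t x = x ↔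
      (((A : R) : H →L[ℂ] H) - algebraMap ℝ (H →L[ℂ] H) t)⁺ x = 0 := by
  rw [← mem_range_spectralProj, Proj.mem_range_iff]
  rfl

/-- `E^A` resolves `A`, because `(A - t)⁺ = (A - t)(1 - E_t)` and `(A - t)⁻ = (t - A)E_t`. -/
theorem resolves_spectralFamily (A : selfAdjoint R) :
    (spectralFamily A).Resolves 0 ((A : R) : H →L[ℂ] H) := by
  have hA : IsSelfAdjoint ((A : R) : H →L[ℂ] H) := congrArg Subtype.val A.2
  set a : H →L[ℂ] H := ((A : R) : H →L[ℂ] H) with ha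
  have key : ∀ t : ℝ, ∃ p n : H →L[ℂ] H, 0 ≤ p ∧ 0 ≤ n ∧ p - n = a - t • 1 ∧
      p * (spectralFamily A).op t = 0 ∧ (spectralFamily A).op t * n = n := by
    intro t
    set c := a - algebraMap ℝ (H →L[ℂ] H) t with hc
    have hcs : IsSelfAdjoint c := hA.sub (.algebraMap _ (.all t))
    refine ⟨c⁺, c⁻, CFC.posPart_nonneg c, CFC.negPart_nonneg c, ?_, ?_, ?_⟩
    · rw [CFC.posPart_sub_negPart c hcs, hc, Algebra.algebraMap_eq_smul_one]
    · ext x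
      refine (spectralFamily_op_apply_eq_iff A t _).1 ?_
      exact congrArg (fun T : H →L[ℂ] H => T x) ((spectralFamily A).op_mul_self t)
    · ext x
      refine (spectralFamily_op_apply_eq_iff A t _).2 ?_
      exact congrArg (fun T : H →L[ℂ] H => T x) (CFC.posPart_mul_negPart c)
  have key2 : ∀ t : ℝ, ∃ p n : H →L[ℂ] H, 0 ≤ p ∧ 0 ≤ n ∧
      (a - t • 1) * (spectralFamily A).op t = -n ∧ (spectralFamily A).op t * (a - t • 1) = -n ∧
      (a - t • 1) * (1 - (spectralFamily A).op t) = p := by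
    intro t
    obtain ⟨p, n, hp, hn, hpn, hpe, hen⟩ := key t
    have hE := ((spectralFamily A).isStarProjection_op t).isSelfAdjoint.star_eq
    have hep : (spectralFamily A).op t * p = 0 := by
      simpa [hE, hp.isSelfAdjoint.star_eq] using congrArg star hpe
    have hne : n * (spectralFamily A).op t = n := by
      simpa [hE, hn.isSelfAdjoint.star_eq] using congrArg star hen
    refine ⟨p, n, hp, hn, ?_, ?_, ?_⟩
    · rw [← hpn, sub_mul, hpe, hne, zero_sub]
    · rw [← hpn, mul_sub, hep, hen, zero_sub]
    · rw [← hpn, mul_sub, mul_one, sub_mul, hpe, hne]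
      abel
  refine ⟨fun t => ?_, fun t => ?_, fun t => ?_⟩ <;>
    obtain ⟨p, n, hp, hn, h1, h2, h3⟩ := key2 t
  · have := h1.trans h2.symm
    rwa [sub_mul, mul_sub, smul_mul_assoc, mul_smul_comm, one_mul, mul_one, sub_left_inj] at this
  · rw [← sub_nonneg]
    convert hp using 1
    rw [← h3, sub_mul, smul_mul_assoc, one_mul]
  · rw [add_zero, ← sub_nonneg]
    convert hn using 1
    rw [← neg_eq_iff_eq_neg.2 h1, sub_mul, smul_mul_assoc, one_mul, neg_sub]

/-- A spectral family that resolves `A` is the spectral family of `A`; right continuity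
enters here. -/
theorem spectralFamily_eq_of_resolves {E : SpectralFamily R} (A : selfAdjoint R)
    (h : E.Resolves 0 ((A : R) : H →L[ℂ] H)) : spectralFamily A = E := by
  set a : H →L[ℂ] H := ((A : R) : H →L[ℂ] H) with ha
  refine SpectralFamily.ext_proj fun t => Proj.eq_of_range fun x => ?_
  have hE := E.op_mul_self t
  have hpos : (a - algebraMap ℝ (H →L[ℂ] H) t)⁺ = (a - t • 1) * (1 - E.op t) := by
    refine (CFC.posPart_negPart_unique (c := (t • 1 - a) * E.op t) ?_ ?_ ?_ ?_).1
    · rw [Algebra.algebraMap_eq_smul_one]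
      noncomm_ring
    · have hc : Commute (t • 1 - a) (E.op t) :=
        ((Commute.one_left _).smul_left t).sub_left (h.commute t)
      rw [hc.eq, mul_assoc, ← mul_assoc (1 - E.op t),
        (E.isStarProjection_op t).one_sub_mul_self, zero_mul, mul_zero]
    · have := sub_nonneg.2 (h.lower t)
      rwa [sub_mul, smul_mul_assoc, one_mul]
    · have := sub_nonneg.2 (h.upper t)
      rwa [add_zero, ← one_mul (E.op t), ← smul_mul_assoc, one_mul, ← sub_mul] at this
  change x ∈ (spectralProj A t).1.range ↔ _
  rw [mem_range_spectralProj, ← ha, hpos]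
  constructor
  · intro hx
    set y := x - E.op t x with hy
    have hay : a y = t • y := sub_eq_zero.1 hx
    -- `y` is an eigenvector of `A` at `t`, so it has no component where `A` is at least `s > t`.
    have hys : ∀ s, t < s → E.op s y = y := by
      intro s hs
      set z := y - E.op s y with hz
      have haz : a z = t • z := by
        have hc : a (E.op s y) = E.op s (a y) :=
          congrArg (fun T : H →L[ℂ] H => T y) (h.commute s).eq
        rw [hz, map_sub, hc, hay, (E.op s).map_smul_of_tower t y]
        exact (smul_sub t y _).symm
      have hEz : E.op s z = 0 := by
        rw [hz, map_sub, sub_eq_zero]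
        exact (congrArg (fun T : H →L[ℂ] H => T y) (E.op_mul_self s)).symm
      have hin := (ContinuousLinearMap.le_def _ _).1 (h.lower s)
      have h0 := hin.re_inner_nonneg_left z
      have hval : (a * (1 - E.op s) - s • (1 - E.op s)) z = (t - s) • z := by
        simp [hEz, haz, sub_smul]
      rw [hval, ← Complex.coe_smul, inner_smul_left] at h0
      simp only [Complex.conj_ofReal, inner_self_eq_norm_sq_to_K] at h0
      have h0' : 0 ≤ (t - s) * ‖z‖ ^ 2 := by
        have e : (((t - s : ℝ) : ℂ) * ((‖z‖ : ℂ) ^ 2)) = (((t - s) * ‖z‖ ^ 2 : ℝ) : ℂ) := by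
          push_cast; ring
        have h0'' : 0 ≤ (((t - s : ℝ) : ℂ) * ((‖z‖ : ℂ) ^ 2)).re := h0
        rwa [e, Complex.ofReal_re] at h0''
      have hz0 : ‖z‖ ^ 2 = 0 := by nlinarith [sq_nonneg ‖z‖]
      have hz1 : z = 0 := by simpa using hz0
      exact (sub_eq_zero.1 hz1).symm
    have hyt : E.op t y = y := by
      rw [SpectralFamily.op, ← Proj.mem_range_iff, ← E.right_cont t, iInf, Proj.range_sInf,
        Submodule.mem_iInf]
      rintro ⟨_, s, rfl⟩
      exact (Proj.mem_range_iff _ _).2 (hys s s.2)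
    have hyt' : E.op t y = 0 := by
      rw [hy, map_sub, sub_eq_zero]
      exact (congrArg (fun T : H →L[ℂ] H => T x) hE).symm
    rw [Proj.mem_range_iff]
    exact (sub_eq_zero.1 (hyt.symm.trans hyt')).symm
  · intro hx
    have hx' : E.op t x = x := (Proj.mem_range_iff _ _).1 hx
    simp [hx']

theorem spectralFamily_injective :
    Function.Injective (spectralFamily : selfAdjoint R → SpectralFamily R) := by
  intro A B h
  have hA := resolves_spectralFamily A
  rw [h] at hA
  exact Subtype.ext (Subtype.ext (hA.eq (resolves_spectralFamily B)))

/-! ### Construction of the operator with a given resolution -/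

namespace SpectralFamily

/-- The left Riemann sum, with `N` steps of width `h` starting at `a`, of
`a + ∫ (1 - E_t) dt`; integration by parts turns this integral into `∫ t dE_t`. -/
def riemannSum (E : SpectralFamily R) (a h : ℝ) (N : ℕ) : H →L[ℂ] H :=
  a • 1 + ∑ k ∈ Finset.range N, h • (1 - E.op (a + k * h))

variable (E : SpectralFamily R)

theorem smul_mem (r : ℝ) {T : H →L[ℂ] H} (hT : T ∈ R) : r • T ∈ R := by
  rw [← Complex.coe_smul]
  exact R.toStarSubalgebra.smul_mem hT (r : ℂ)

theorem riemannSum_mem (a h : ℝ) (N : ℕ) : E.riemannSum a h N ∈ R :=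
  add_mem (smul_mem a (one_mem R)) (sum_mem fun _ _ =>
    smul_mem h (sub_mem (one_mem R) (E.op_mem _)))

theorem commute_riemannSum (a h : ℝ) (N : ℕ) (t : ℝ) :
    Commute (E.riemannSum a h N) (E.op t) :=
  ((Commute.one_left _).smul_left a).add_left (Commute.sum_left _ _ _ fun _ _ =>
    ((Commute.one_left _).sub_left (E.commute_op _ t)).smul_left h)

theorem add_succ_mul_eq (a h : ℝ) (k : ℕ) : a + (k + 1 : ℕ) * h = a + k * h + h := by
  push_cast; ring

/-- Truncating the partition points at `t + h` makes the coefficients of the summands that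
survive multiplication by `E_t` telescope. -/
theorem riemannSum_mul_op_le {a h t : ℝ} (hh : 0 ≤ h) (hat : a ≤ t) (N : ℕ) :
    E.riemannSum a h N * E.op t ≤ (t + h) • E.op t := by
  have hterm : ∀ k ∈ Finset.range N, h • (1 - E.op (a + k * h)) * E.op t ≤
      (min (a + (k + 1 : ℕ) * h) (t + h) - min (a + k * h) (t + h)) • E.op t := by
    intro k _
    rw [add_succ_mul_eq]
    set s := a + k * h
    have hE := (E.isStarProjection_op t).nonneg
    rcases lt_or_ge s t with hs | hs
    · rw [min_eq_left (by linarith), min_eq_left (by linarith), add_sub_cancel_left,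
        smul_mul_assoc, sub_mul, one_mul, E.op_mul_op_of_le hs.le]
      exact smul_le_smul_of_nonneg_left (sub_le_self _ (E.isStarProjection_op s).nonneg) hh
    · rw [smul_mul_assoc, sub_mul, one_mul, E.op_mul_op_of_ge hs, sub_self, smul_zero]
      refine smul_nonneg (sub_nonneg.2 ?_) hE
      exact min_le_min_right _ (by linarith)
  rw [riemannSum, add_mul, Finset.sum_mul]
  calc _ ≤ a • 1 * E.op t + ∑ k ∈ Finset.range N,
        (min (a + (k + 1 : ℕ) * h) (t + h) - min (a + k * h) (t + h)) • E.op t := by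
        gcongr with k hk
        exact hterm k hk
    _ = (a + (min (a + N * h) (t + h) - min a (t + h))) • E.op t := by
        rw [← Finset.sum_smul, Finset.sum_range_sub (fun k : ℕ => min (a + k * h) (t + h)),
          smul_mul_assoc, one_mul, ← add_smul]
        simp
    _ ≤ (t + h) • E.op t := by
        refine smul_le_smul_of_nonneg_right ?_ (E.isStarProjection_op t).nonneg
        rw [min_eq_left (by linarith : a ≤ t + h)]
        linarith [min_le_right (a + N * h) (t + h)]

/-- Truncating the partition points at `t` makes the coefficients of a lower bound for the sum
on the range of `1 - E_t` telescope. -/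
theorem le_riemannSum_mul_one_sub_op {a h t : ℝ} (hh : 0 ≤ h) {N : ℕ} (ht : t ≤ a + N * h) :
    t • (1 - E.op t) ≤ E.riemannSum a h N * (1 - E.op t) := by
  have hterm : ∀ k ∈ Finset.range N,
      (min (a + (k + 1 : ℕ) * h) t - min (a + k * h) t) • (1 - E.op t) ≤
        h • (1 - E.op (a + k * h)) * (1 - E.op t) := by
    intro k _
    rw [add_succ_mul_eq]
    set s := a + k * h
    have hE := (E.isStarProjection_op t).one_sub.nonneg
    rcases le_or_gt s t with hs | hs
    · have e : (1 - E.op s) * (1 - E.op t) = 1 - E.op t := by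
        rw [sub_mul, one_mul, mul_sub, mul_one, E.op_mul_op_of_le hs, sub_self, sub_zero]
      rw [smul_mul_assoc, e, min_eq_left hs]
      exact smul_le_smul_of_nonneg_right (by linarith [min_le_left (s + h) t]) hE
    · have e : (1 - E.op s) * (1 - E.op t) = 1 - E.op s := by
        rw [sub_mul, one_mul, mul_sub, mul_one, E.op_mul_op_of_ge hs.le]
        abel
      rw [smul_mul_assoc, e, min_eq_right (by linarith), min_eq_right hs.le, sub_self, zero_smul]
      exact smul_nonneg hh (E.isStarProjection_op s).one_sub.nonneg
  rw [riemannSum, add_mul, Finset.sum_mul]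
  calc t • (1 - E.op t) ≤ (a + (min (a + N * h) t - min a t)) • (1 - E.op t) := by
        refine smul_le_smul_of_nonneg_right ?_ (E.isStarProjection_op t).one_sub.nonneg
        rw [min_eq_right ht]
        linarith [min_le_left a t]
    _ = a • 1 * (1 - E.op t) + ∑ k ∈ Finset.range N,
        (min (a + (k + 1 : ℕ) * h) t - min (a + k * h) t) • (1 - E.op t) := by
        rw [← Finset.sum_smul, Finset.sum_range_sub (fun k : ℕ => min (a + k * h) t),
          smul_mul_assoc, one_mul, ← add_smul]
        simp
    _ ≤ _ := by
        gcongr with k hk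
        exact hterm k hk

theorem exists_resolves_of_pos {ε : ℝ} (hε : 0 < ε) : ∃ T ∈ R, E.Resolves ε T := by
  obtain ⟨a, ha⟩ := E.exists_op_eq_zero
  obtain ⟨b, hb⟩ := E.exists_op_eq_one
  obtain ⟨N, hN⟩ := exists_nat_ge ((b - a) / ε)
  rw [div_le_iff₀ hε] at hN
  refine ⟨E.riemannSum a ε N, E.riemannSum_mem a ε N, E.commute_riemannSum a ε N,
    fun t => ?_, fun t => ?_⟩
  · rcases le_or_gt b t with ht | ht
    · simp [hb t ht]
    · exact E.le_riemannSum_mul_one_sub_op hε.le (by linarith)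
  · rcases lt_or_ge t a with ht | ht
    · simp [ha t ht]
    · exact E.riemannSum_mul_op_le hε.le ht N

theorem isClosed_vonNeumannAlgebra (R : VonNeumannAlgebra H) :
    IsClosed (R : Set (H →L[ℂ] H)) := by
  rw [← R.commutant_commutant, VonNeumannAlgebra.coe_commutant]
  exact Set.isClosed_centralizer _

/-- Every bounded spectral family in `R` resolves an element of `R`, the norm limit of
operators resolved up to smaller and smaller errors. -/
theorem exists_resolves : ∃ T ∈ R, E.Resolves 0 T := by
  choose S hSR hS using fun n : ℕ =>
    E.exists_resolves_of_pos (Nat.one_div_pos_of_nat (α := ℝ) (n := n))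
  have hlim : Tendsto (fun n : ℕ => 1 / ((n : ℝ) + 1)) atTop (𝓝 0) :=
    tendsto_one_div_add_atTop_nhds_zero_nat
  have hcauchy : CauchySeq S := by
    refine cauchySeq_of_le_tendsto_0 (fun n : ℕ => 3 * (2 * (1 / ((n : ℝ) + 1)))) ?_
      (by simpa using (hlim.const_mul 2).const_mul 3)
    intro n m N hn hm
    have hpos : 0 < 1 / ((N : ℝ) + 1) := Nat.one_div_pos_of_nat
    rw [dist_eq_norm]
    exact ((hS n).mono (Nat.one_div_le_one_div hn)).norm_sub_le
      ((hS m).mono (Nat.one_div_le_one_div hm)) (by positivity) (by linarith)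
  obtain ⟨T, hT⟩ := cauchySeq_tendsto_of_complete hcauchy
  refine ⟨T, (isClosed_vonNeumannAlgebra R).mem_of_tendsto hT (.of_forall hSR),
    fun t => ?_, fun t => ?_, fun t => ?_⟩
  · refine tendsto_nhds_unique (hT.mul_const (E.op t)) ?_
    simp_rw [((hS _).commute t).eq]
    exact hT.const_mul (E.op t)
  · exact ge_of_tendsto' (hT.mul_const _) fun n => (hS n).lower t
  · refine le_of_tendsto_of_tendsto' (hT.mul_const _) ?_ fun n => (hS n).upper t
    exact (hlim.const_add t).smul_const (E.op t)

end SpectralFamily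

theorem spectralFamily_surjective :
    Function.Surjective (spectralFamily : selfAdjoint R → SpectralFamily R) := by
  intro E
  obtain ⟨T, hTR, hT⟩ := E.exists_resolves
  exact ⟨⟨⟨T, hTR⟩, Subtype.ext hT.isSelfAdjoint⟩, spectralFamily_eq_of_resolves _ hT⟩

theorem spectralFamily_bijective :
    Function.Bijective (spectralFamily : selfAdjoint R → SpectralFamily R) :=
  ⟨spectralFamily_injective, spectralFamily_surjective⟩

/-! ### The lattice of the spectral order -/

theorem SpecLE.antisymm {A B : selfAdjoint R} (h : SpecLE A B) (h' : SpecLE B A) : A = B :=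
  spectralFamily_injective (SpectralFamily.ext_proj fun t => le_antisymm (h' t) (h t))

theorem IsSpecMeet.specLE_left {A B C : selfAdjoint R} (h : IsSpecMeet A B C) :
    SpecLE C A := by
  intro t
  rw [h, ← (spectralFamily A).right_cont t]
  exact iInf_mono fun s => le_sup_left

theorem IsSpecMeet.specLE_right {A B C : selfAdjoint R} (h : IsSpecMeet A B C) :
    SpecLE C B := by
  intro t
  rw [h, ← (spectralFamily B).right_cont t]
  exact iInf_mono fun s => le_sup_right

theorem IsSpecMeet.le_specLE {A B C X : selfAdjoint R} (h : IsSpecMeet A B C)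
    (hA : SpecLE X A) (hB : SpecLE X B) : SpecLE X C := by
  intro t
  rw [h, ← (spectralFamily X).right_cont t]
  exact iInf_mono fun s => sup_le (hA s) (hB s)

theorem IsSpecJoin.specLE_left {A B D : selfAdjoint R} (h : IsSpecJoin A B D) :
    SpecLE A D := by
  intro t
  rw [h]
  exact inf_le_left

theorem IsSpecJoin.specLE_right {A B D : selfAdjoint R} (h : IsSpecJoin A B D) :
    SpecLE B D := by
  intro t
  rw [h]
  exact inf_le_right

theorem IsSpecJoin.specLE_le {A B D X : selfAdjoint R} (h : IsSpecJoin A B D)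
    (hA : SpecLE A X) (hB : SpecLE B X) : SpecLE D X := by
  intro t
  rw [h]
  exact le_inf (hA t) (hB t)

theorem existsUnique_isSpecMeet (A B : selfAdjoint R) : ∃! C, IsSpecMeet A B C :=
  spectralFamily_bijective.existsUnique _

theorem existsUnique_isSpecJoin (A B : selfAdjoint R) : ∃! D, IsSpecJoin A B D :=
  spectralFamily_bijective.existsUnique _

/-- The lattice structure on `R_sa` given by the spectral order. -/
@[reducible]
def specLattice (R : VonNeumannAlgebra H) : Lattice (selfAdjoint R) where
  le := SpecLE
  -- Given explicitly, since `selfAdjoint R` already carries the usual operator order.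
  lt A B := SpecLE A B ∧ ¬SpecLE B A
  lt_iff_le_not_ge _ _ := Iff.rfl
  le_refl _ _ := le_rfl
  le_trans _ _ _ h h' t := (h' t).trans (h t)
  le_antisymm _ _ := SpecLE.antisymm
  inf A B := (existsUnique_isSpecMeet A B).choose
  inf_le_left A B := (existsUnique_isSpecMeet A B).choose_spec.1.specLE_left
  inf_le_right A B := (existsUnique_isSpecMeet A B).choose_spec.1.specLE_right
  le_inf _ B C := (existsUnique_isSpecMeet B C).choose_spec.1.le_specLE
  sup A B := (existsUnique_isSpecJoin A B).choose
  le_sup_left A B := (existsUnique_isSpecJoin A B).choose_spec.1.specLE_left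
  le_sup_right A B := (existsUnique_isSpecJoin A B).choose_spec.1.specLE_right
  sup_le A B _ := (existsUnique_isSpecJoin A B).choose_spec.1.specLE_le

end SpectralOrder

end

theorem mainTheorem3 {H : Type*} [NormedAddCommGroup H] [InnerProductSpace ℂ H]
    [CompleteSpace H] (R : VonNeumannAlgebra H) :
    (∀ A B : selfAdjoint R,
      (∃! C : selfAdjoint R, SpectralOrder.IsSpecMeet A B C) ∧
      (∃! D : selfAdjoint R, SpectralOrder.IsSpecJoin A B D)) ∧
    (∀ A B C : selfAdjoint R, SpectralOrder.IsSpecMeet A B C →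
      SpectralOrder.SpecLE C A ∧ SpectralOrder.SpecLE C B ∧
      ∀ X : selfAdjoint R, SpectralOrder.SpecLE X A → SpectralOrder.SpecLE X B →
        SpectralOrder.SpecLE X C) ∧
    (∀ A B D : selfAdjoint R, SpectralOrder.IsSpecJoin A B D →
      SpectralOrder.SpecLE A D ∧ SpectralOrder.SpecLE B D ∧
      ∀ X : selfAdjoint R, SpectralOrder.SpecLE A X → SpectralOrder.SpecLE B X →
        SpectralOrder.SpecLE D X) ∧
    ∃ L : Lattice (selfAdjoint R),
      (∀ A B : selfAdjoint R, L.le A B ↔ SpectralOrder.SpecLE A B) ∧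
      (∀ A B : selfAdjoint R, SpectralOrder.IsSpecMeet A B (L.inf A B)) ∧
      (∀ A B : selfAdjoint R, SpectralOrder.IsSpecJoin A B (L.sup A B)) := by
  refine ⟨fun A B => ⟨SpectralOrder.existsUnique_isSpecMeet A B,
      SpectralOrder.existsUnique_isSpecJoin A B⟩,
    fun A B C h => ⟨h.specLE_left, h.specLE_right, fun X => h.le_specLE⟩,
    fun A B D h => ⟨h.specLE_left, h.specLE_right, fun X => h.specLE_le⟩,
    SpectralOrder.specLattice R, fun A B => Iff.rfl,
    fun A B => (SpectralOrder.existsUnique_isSpecMeet A B).choose_spec.1,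
    fun A B => (SpectralOrder.existsUnique_isSpecJoin A B).choose_spec.1⟩
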